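/- Let $\phi_{(1)}=\chi_{[0,1]}*\chi_{[0,1]}$ and $\psi_{(1)}(t)=\phi_{(1)}(2t)-\phi_{(1)}(2t-2)$, $t\in\mathbb R$. Write $\widehat f(\xi)=\int_{\mathbb R}f(x)e^{-2\pi i x\xi}\,dx$, $\Phi_f(\xi)=\sum_{k\in\mathbb Z}|\widehat f(\xi+k)|^2$, and let $S(\psi_{(1)})$ be the closed linear span in $L^2(\mathbb R)$ of $\{\psi_{(1)}(\cdot+k)\}_{k\in\mathbb Z}$. A function $w\ge 0$ on $\mathbb R$ has a singularity of order $k\in\{1,2,\dots\}$ at $x_0$ if there is an interval $I$ with center $x_0$ such that $(x-x_0)^{2(k-1)}/w(x)\notin L^1(I)$ but $(x-x_0)^{2k}/w(x)\in L^1(I)$. For $\alpha>0$ put $A_n^\alpha=\prod_{j=1}^n\frac{\alpha+j}{j}$; the $(C,\alpha)$ means of a series $\sum_{k\ge0}u_k$ are $\sigma_n^\alpha=\frac1{A_n^\alpha}\sum_{k=0}^nA_{n-k}^\alpha u_k$. Then: (1) For every $\xi\in\mathbb R$ the series defining $\Phi_{\psi_{(1)}}(\xi)$ converges and $\Phi_{\psi_{(1)}}(\xi)=\frac43\sin^2(\pi\xi)$.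 (2) $\Phi_{\psi_{(1)}}$ has a singularity of order $k$ at $x_0$ if and only if $x_0\in\mathbb Z$ and $k=1$. That is, on $\mathbb T=\mathbb R/\mathbb Z$ its only singularity is at $0$, and it has order $1$. (3) For every $\alpha>\frac12$ the system $\{\psi_{(1)}(\cdot+k)\}_{k\in\mathbb Z\setminus\{0\}}$ in its natural enumeration is a $(C,\alpha)$ summation basis of $S(\psi_{(1)})$. That is, there are continuous linear functionals $c_k$ ($k\neq0$) on $S(\psi_{(1)})$, biorthogonal to the system, such that for every $f\in S(\psi_{(1)})$ the series $\sum_{k\ne0}c_k(f)\,\psi_{(1)}(\cdot+k)$ is $(C,\alpha)$ summable to $f$ in $L^2(\mathbb R)$, and no other series $\sum_{k\neq0}a_k\psi_{(1)}(\cdot+k)$ with complex coefficients is. This holds both when the terms are taken one at a time in the order $k=1,-1,2,-2,\dots$ and when the terms with indices $m$ and $-m$ are taken together, so that the means are $\frac1{A_n^\alpha}\sum_{0<|k|\le n}A_{n-|k|}^\alpha a_k\psi_{(1)}(\cdot+k)$. -/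

import Mathlib

open MeasureTheory Filter Topology
open scoped FourierTransform Convolution ENNReal

noncomputable section

/-! ### Shift-invariant spaces -/

/-- The translate `f (· + k)` as an element of `L²(ℝ)`. -/
def shiftLp (f : ℝ → ℂ) (hf : MemLp f 2 volume) (k : ℤ) : Lp ℂ 2 (volume : Measure ℝ) :=
  (hf.comp_measurePreserving (measurePreserving_add_right volume (k : ℝ))).toLp

theorem shiftLp_coe (f : ℝ → ℂ) (hf : MemLp f 2 volume) (k : ℤ) :
    shiftLp f hf k =ᵐ[volume] fun x => f (x + k) :=
  MemLp.coeFn_toLp _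

/-- The principal shift-invariant space `S(f)`: the closed linear span in `L²(ℝ)` of the
integer translates of `f`. -/
def shiftSpace (f : ℝ → ℂ) (hf : MemLp f 2 volume) :
    Submodule ℂ (Lp ℂ 2 (volume : Measure ℝ)) :=
  (Submodule.span ℂ (Set.range (shiftLp f hf))).topologicalClosure

theorem shiftLp_mem (f : ℝ → ℂ) (hf : MemLp f 2 volume) (k : ℤ) :
    shiftLp f hf k ∈ shiftSpace f hf :=
  Submodule.le_topologicalClosure _ (Submodule.subset_span ⟨k, rfl⟩)

/-- The system of translates `f (· + k)`, `k ≠ 0`, in `S(f)`. -/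
def shiftSystem (f : ℝ → ℂ) (hf : MemLp f 2 volume) (k : {k : ℤ // k ≠ 0}) :
    shiftSpace f hf :=
  ⟨shiftLp f hf k, shiftLp_mem f hf k⟩

/-- The periodization `Φ_f(ξ) = ∑_{k ∈ ℤ} |f̂(ξ + k)|²`, where
`f̂(ξ) = ∫ f(x) exp(-2πixξ) dx`. -/
def periodization (f : ℝ → ℂ) (ξ : ℝ) : ℝ :=
  ∑' k : ℤ, ‖𝓕 f (ξ + k)‖ ^ 2

/-- A nonnegative function `w` has a singularity of order `k ≥ 1` at `x₀` if on some interval `I`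
centred at `x₀` the function `(x - x₀)^(2(k-1)) / w(x)` is not integrable while
`(x - x₀)^(2k) / w(x)` is.  The quotients are taken in `[0, ∞]`, so that they are `∞` where only
the denominator vanishes. -/
def HasSingularityOfOrder (w : ℝ → ℝ) (k : ℕ) (x₀ : ℝ) : Prop :=
  1 ≤ k ∧ ∃ r > 0,
    ∫⁻ x in Set.Ioo (x₀ - r) (x₀ + r),
      ENNReal.ofReal ((x - x₀) ^ (2 * (k - 1))) / ENNReal.ofReal (w x) = ∞ ∧
    ∫⁻ x in Set.Ioo (x₀ - r) (x₀ + r),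
      ENNReal.ofReal ((x - x₀) ^ (2 * k)) / ENNReal.ofReal (w x) < ∞

/-! ### Cesàro summation -/

/-- The Cesàro number `A_n^α = (α + 1) ⋯ (α + n) / n!`, the binomial coefficient of `n + α`
over `n`. -/
def cesaroNumber (α : ℝ) (n : ℕ) : ℝ :=
  ∏ j ∈ Finset.range n, (α + (j + 1)) / (j + 1)

/-- The `(C, α)` mean `σ_n^α = (1 / A_n^α) ∑_{k ≤ n} A_{n-k}^α u_k` of the series `∑ u_k`. -/
def cesaroMean {E : Type*} [NormedAddCommGroup E] [NormedSpace ℂ E]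
    (α : ℝ) (u : ℕ → E) (n : ℕ) : E :=
  ((cesaroNumber α n)⁻¹ : ℂ) •
    ∑ k ∈ Finset.range (n + 1), (cesaroNumber α (n - k) : ℂ) • u k

/-- `y` is a `(C, α)` summation basis of `E`, where series `∑ a_k y_k` are read as
`∑_m ∑_{k ∈ block m} a_k y_k` with finite blocks partitioning the index set.
There is a biorthogonal system `c` of continuous functionals such that, for every `x`, the series
with coefficients `c_k(x)`, and no other series in the system, is `(C, α)` summable in norm
to `x`. -/
def IsCesaroBasis {E ι : Type*} [NormedAddCommGroup E] [NormedSpace ℂ E] [DecidableEq ι]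
    (α : ℝ) (y : ι → E) (block : ℕ → Finset ι) : Prop :=
  ∃ c : ι → E →L[ℂ] ℂ,
    (∀ k j, c k (y j) = if k = j then 1 else 0) ∧
    ∀ (x : E) (a : ι → ℂ),
      Tendsto (cesaroMean α fun m => ∑ k ∈ block m, a k • y k) atTop (𝓝 x) ↔
        ∀ k, a k = c k x

/-- The enumeration `1, -1, 2, -2, 3, -3, …` of the nonzero integers. -/
def naturalEnum (j : ℕ) : {k : ℤ // k ≠ 0} :=
  if j % 2 = 0 then ⟨(j / 2 : ℕ) + 1, by omega⟩ else ⟨-((j / 2 : ℕ) + 1), by omega⟩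

theorem naturalEnum_bijective : Function.Bijective naturalEnum := by
  constructor
  · intro i j h
    unfold naturalEnum at h
    split_ifs at h <;> simp only [Subtype.mk.injEq] at h <;> omega
  · rintro ⟨k, hk⟩
    rcases lt_or_gt_of_ne hk with h | h
    · refine ⟨2 * (-k).toNat - 1, ?_⟩
      unfold naturalEnum
      split_ifs <;> simp only [Subtype.mk.injEq] <;> omega
    · refine ⟨2 * k.toNat - 2, ?_⟩
      unfold naturalEnum
      split_ifs <;> simp only [Subtype.mk.injEq] <;> omega

/-- One term at a time, in the order `1, -1, 2, -2, …`. -/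
def singleBlock (m : ℕ) : Finset {k : ℤ // k ≠ 0} := {naturalEnum m}

/-- The terms with indices `m` and `-m` taken together (no term for `m = 0`); the corresponding
`(C, α)` means are `(1 / A_n^α) ∑_{0 < |k| ≤ n} A_{n-|k|}^α a_k y_k`. -/
def symmetricBlock (m : ℕ) : Finset {k : ℤ // k ≠ 0} :=
  ({(m : ℤ), -(m : ℤ)} : Finset ℤ).subtype (· ≠ 0)

theorem mem_symmetricBlock (m : ℕ) (k : {k : ℤ // k ≠ 0}) :
    k ∈ symmetricBlock m ↔ (k : ℤ).natAbs = m := by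
  obtain ⟨k, hk⟩ := k
  simp only [symmetricBlock, Finset.mem_subtype, Finset.mem_insert, Finset.mem_singleton]
  omega

/-! ### The example -/

/-- The indicator function of `[0, 1]`. -/
def unitBox : ℝ → ℂ := Set.indicator (Set.Icc 0 1) 1

/-- `φ₁ = χ_[0,1] * χ_[0,1]`. -/
def phiOne : ℝ → ℂ := unitBox ⋆[ContinuousLinearMap.mul ℂ ℂ, volume] unitBox

/-- `ψ₁(t) = φ₁(2t) - φ₁(2t - 2)`. -/
def psiOne (t : ℝ) : ℂ := phiOne (2 * t) - phiOne (2 * t - 2)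

theorem phiOne_apply (t : ℝ) :
    phiOne t = ((max (min 1 t - max 0 (t - 1)) 0 : ℝ) : ℂ) := by
  have h : ∀ s : ℝ, (ContinuousLinearMap.mul ℂ ℂ (unitBox s)) (unitBox (t - s)) =
      Set.indicator (Set.Icc (max 0 (t - 1)) (min 1 t)) (fun _ => (1 : ℂ)) s := by
    intro s
    have e : s ∈ Set.Icc (max 0 (t - 1)) (min 1 t) ↔
        s ∈ Set.Icc (0 : ℝ) 1 ∧ t - s ∈ Set.Icc (0 : ℝ) 1 := by
      simp only [Set.mem_Icc, max_le_iff, le_min_iff]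
      constructor
      · rintro ⟨⟨h1, h2⟩, h3, h4⟩
        exact ⟨⟨h1, h3⟩, by linarith, by linarith⟩
      · rintro ⟨⟨h1, h2⟩, h3, h4⟩
        exact ⟨⟨h1, by linarith⟩, h2, by linarith⟩
    by_cases h1 : s ∈ Set.Icc (0 : ℝ) 1 <;> by_cases h2 : t - s ∈ Set.Icc (0 : ℝ) 1 <;>
      simp only [unitBox, ContinuousLinearMap.mul_apply', Set.indicator, e, h1, h2] <;> simp
  unfold phiOne convolution
  simp_rw [h]
  rw [integral_indicator measurableSet_Icc]
  simp [Measure.real, Real.volume_Icc, ENNReal.toReal_ofReal']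

theorem phiOne_continuous : Continuous phiOne := by
  have : phiOne = fun t : ℝ => ((max (min 1 t - max 0 (t - 1)) 0 : ℝ) : ℂ) :=
    funext phiOne_apply
  rw [this]
  fun_prop

theorem psiOne_continuous : Continuous psiOne := by
  have := phiOne_continuous
  unfold psiOne
  fun_prop

theorem phiOne_eq_zero (t : ℝ) (ht : t ∉ Set.Icc (0 : ℝ) 2) : phiOne t = 0 := by
  rw [phiOne_apply]
  norm_cast
  apply max_eq_right
  simp only [Set.mem_Icc, not_and_or, not_le] at ht
  rcases ht with h | h
  · linarith [min_le_right 1 t, le_max_left 0 (t - 1)]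
  · linarith [min_le_left 1 t, le_max_right 0 (t - 1)]

theorem psiOne_hasCompactSupport : HasCompactSupport psiOne := by
  apply HasCompactSupport.intro (isCompact_Icc (a := (0 : ℝ)) (b := 2))
  intro t ht
  simp only [Set.mem_Icc, not_and_or, not_le] at ht
  unfold psiOne
  rw [phiOne_eq_zero, phiOne_eq_zero, sub_zero] <;>
    simp only [Set.mem_Icc, not_and_or, not_le] <;> rcases ht with h | h
  · left; linarith
  · right; linarith
  · left; linarith
  · right; linarith

theorem psiOne_memLp : MemLp psiOne 2 (volume : Measure ℝ) :=
  psiOne_continuous.memLp_of_hasCompactSupport psiOne_hasCompactSupport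

end

/-! Everything rests on `psiOne t = tent t - tent (t - 1)`, where `tent` lives on `[0, 1]`, so that
its integer translates are orthogonal, with squared norm `1/3`.

On the Fourier side the difference contributes the factor `|1 - exp(-2πiξ)|² = 4 sin²(πξ)`, which
has period `1`, and Parseval on `[0, 1]` shows that the periodization of `tent` is the constant
`1/3`. The singularities are then those of `1/sin²(πξ)`: double poles at the integers.

In `ℓ²(ℤ)`, with `e_k` standing for `√3 • tent (· + k)`, the system is a multiple of `e_k -
e_{k-1}`, `k ≠ 0`. The `j`-th coordinate of `∑ a_k (e_k - e_{k-1})` is `a_j - a_{j+1}` with `a_0 =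
0`, so the target `z` determines `a`: its entries are, up to sign, partial sums of `z`
(`diffCoeff`). Hence uniqueness and biorthogonality.

For convergence let `W_j` be the Cesàro weight of the `j`-th term. Summation by parts turns the
coordinate `W_j a_j - W_{j+1} a_{j+1}` of the mean into `p_j z_j + (W_j - W_{j+1}) g_j`, where `p_j`
is one of the two weights and `g_j` one of `a_j`, `a_{j+1}`. The first part tends to `z` by
dominated convergence. In the second, `|g_j|² = o(n)` uniformly for `|j| ≤ n + 2`
(`norm_sq_diffCoeff_le`), while `∑ (W_j - W_{j+1})² = O(1/n)` (`sum_sq_cesaroWeight_sub_le`); the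
latter is where `α > 1/2` enters. -/

/-! ### The tent function and the periodization -/

/-- The tent function `phiOne (2 t)`, supported on `[0, 1]`. -/
noncomputable def tent (t : ℝ) : ℂ := phiOne (2 * t)

theorem tent_apply (t : ℝ) : tent t = ((max (1 - |2 * t - 1|) 0 : ℝ) : ℂ) := by
  unfold tent
  rw [phiOne_apply]
  congr 2
  rcases le_total (2 * t) 1 with h | h
  · rw [min_eq_right h, max_eq_left (by linarith), abs_of_nonpos (by linarith)]; ring
  · rw [min_eq_left h, max_eq_right (by linarith), abs_of_nonneg (by linarith)]

theorem tent_continuous : Continuous tent :=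
  phiOne_continuous.comp (by fun_prop)

theorem tent_eq_zero {t : ℝ} (ht : t ∉ Set.Ioo (0 : ℝ) 1) : tent t = 0 := by
  rw [tent_apply]
  norm_cast
  apply max_eq_right
  simp only [Set.mem_Ioo, not_and_or, not_lt] at ht
  rcases ht with h | h
  · rw [abs_of_nonpos (by linarith)]; linarith
  · rw [abs_of_nonneg (by linarith)]; linarith

theorem tent_hasCompactSupport : HasCompactSupport tent :=
  HasCompactSupport.intro (isCompact_Icc (a := (0 : ℝ)) (b := 1)) fun _ ht =>
    tent_eq_zero fun h => ht (Set.Ioo_subset_Icc_self h)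

theorem tent_memLp : MemLp tent 2 (volume : Measure ℝ) :=
  tent_continuous.memLp_of_hasCompactSupport tent_hasCompactSupport

theorem psiOne_eq_tent (t : ℝ) : psiOne t = tent t - tent (t - 1) := by
  unfold psiOne tent
  ring_nf

theorem integral_norm_sq_tent : ∫ t in (0 : ℝ)..1, ‖tent t‖ ^ 2 = 1 / 3 := by
  have hc : Continuous fun t => ‖tent t‖ ^ 2 := by
    have := tent_continuous
    fun_prop
  rw [← intervalIntegral.integral_add_adjacent_intervals (b := 1 / 2)
    (hc.intervalIntegrable _ _) (hc.intervalIntegrable _ _)]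
  have h1 : ∫ t in (0 : ℝ)..(1 / 2), ‖tent t‖ ^ 2 = ∫ t in (0 : ℝ)..(1 / 2), 4 * t ^ 2 := by
    apply intervalIntegral.integral_congr
    intro t ht
    rw [Set.uIcc_of_le (by norm_num)] at ht
    simp only [tent_apply, Complex.norm_real, Real.norm_eq_abs, sq_abs]
    rw [abs_of_nonpos (by linarith [ht.2]), max_eq_left (by linarith [ht.1])]
    ring
  have h2 : ∫ t in (1 / 2 : ℝ)..1, ‖tent t‖ ^ 2 =
      ∫ t in (1 / 2 : ℝ)..1, (4 - 8 * t ^ 1 + 4 * t ^ 2) := by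
    apply intervalIntegral.integral_congr
    intro t ht
    rw [Set.uIcc_of_le (by norm_num)] at ht
    simp only [tent_apply, Complex.norm_real, Real.norm_eq_abs, sq_abs]
    rw [abs_of_nonneg (by linarith [ht.1]), max_eq_left (by linarith [ht.2])]
    ring
  rw [h1, h2, intervalIntegral.integral_add, intervalIntegral.integral_sub]
  · simp only [intervalIntegral.integral_const_mul, integral_pow, intervalIntegral.integral_const]
    norm_num
  all_goals exact Continuous.intervalIntegrable (by fun_prop) _ _

/-- Since `tent` vanishes off `(0, 1)`, the Fourier integral is already an integral over one period.
This prepares Parseval for the modulated tent, whose modulus does not depend on `ξ`. -/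
theorem fourier_tent_add_int (ξ : ℝ) (k : ℤ) :
    𝓕 tent (ξ + k) = fourierCoeffOn (zero_lt_one' ℝ)
      (fun t => Complex.exp (-2 * Real.pi * Complex.I * ξ * t) * tent t) k := by
  rw [fourierCoeffOn_eq_integral, Real.fourier_real_eq_integral_exp_smul,
    ← setIntegral_eq_integral_of_forall_compl_eq_zero (s := Set.Ioc 0 1),
    intervalIntegral.integral_of_le zero_le_one]
  · simp only [sub_zero, div_one, one_smul]
    refine setIntegral_congr_fun measurableSet_Ioc fun t _ => ?_
    simp only [smul_eq_mul, ← mul_assoc]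
    congr 1
    rw [fourier_coe_apply, ← Complex.exp_add]
    congr 1
    push_cast
    ring
  · intro t ht
    rw [tent_eq_zero fun h => ht (Set.Ioo_subset_Ioc_self h), smul_zero]

theorem hasSum_norm_sq_fourier_tent (ξ : ℝ) :
    HasSum (fun k : ℤ => ‖𝓕 tent (ξ + k)‖ ^ 2) (1 / 3) := by
  have hn : ∀ t : ℝ, ‖Complex.exp (-2 * Real.pi * Complex.I * ξ * t)‖ = 1 := fun t => by
    rw [show -2 * Real.pi * Complex.I * ξ * t = ((-2 * Real.pi * ξ * t : ℝ) : ℂ) * Complex.I by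
      push_cast; ring]
    exact Complex.norm_exp_ofReal_mul_I _
  have hg : ∀ t : ℝ, ‖Complex.exp (-2 * Real.pi * Complex.I * ξ * t) * tent t‖ = ‖tent t‖ :=
    fun t => by rw [norm_mul, hn, one_mul]
  have hc : Continuous fun t : ℝ => Complex.exp (-2 * Real.pi * Complex.I * ξ * t) * tent t := by
    have := tent_continuous
    fun_prop
  have hm := MemLp.of_le (tent_memLp.restrict (Set.Ioc 0 1)) hc.aestronglyMeasurable
    (Eventually.of_forall fun t => (hg t).le)
  have h := hasSum_sq_fourierCoeffOn (zero_lt_one' ℝ) hm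
  simp only [hg, sub_zero, inv_one, one_smul, integral_norm_sq_tent] at h
  simpa only [fourier_tent_add_int] using h

theorem fourier_psiOne (ξ : ℝ) :
    𝓕 psiOne ξ = (1 - Complex.exp (Complex.I * (-2 * Real.pi * ξ : ℝ))) * 𝓕 tent ξ := by
  have hi : ∀ g : ℝ → ℂ, Continuous g → HasCompactSupport g → Integrable fun v : ℝ =>
      Complex.exp (↑(-2 * Real.pi * v * ξ) * Complex.I) • g v := fun g h1 h2 => by
    have he : Continuous fun v : ℝ => Complex.exp (↑(-2 * Real.pi * v * ξ) * Complex.I) := by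
      fun_prop
    refine (he.smul h1).integrable_of_hasCompactSupport ?_
    refine h2.mono fun v hv h => hv ?_
    change Complex.exp _ * g v = 0
    rw [h, mul_zero]
  have hs : ∫ v : ℝ, Complex.exp (↑(-2 * Real.pi * v * ξ) * Complex.I) • tent (v - 1) =
      Complex.exp (Complex.I * (-2 * Real.pi * ξ : ℝ)) *
        ∫ v : ℝ, Complex.exp (↑(-2 * Real.pi * v * ξ) * Complex.I) • tent v := by
    rw [← integral_const_mul, ← integral_add_right_eq_self _ (1 : ℝ)]
    refine integral_congr_ae (Eventually.of_forall fun v => ?_)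
    simp only [add_sub_cancel_right, smul_eq_mul, ← mul_assoc]
    rw [← Complex.exp_add]
    congr 2
    push_cast
    ring
  rw [Real.fourier_real_eq_integral_exp_smul, Real.fourier_real_eq_integral_exp_smul, sub_mul,
    one_mul, ← hs, ← integral_sub]
  · simp only [psiOne_eq_tent, smul_sub]
  · exact hi _ tent_continuous tent_hasCompactSupport
  · exact hi (fun v => tent (v - 1)) (tent_continuous.comp (by fun_prop))
      (tent_hasCompactSupport.comp_homeomorph (Homeomorph.subRight 1))

theorem norm_sq_fourier_psiOne (ξ : ℝ) (k : ℤ) :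
    ‖𝓕 psiOne (ξ + k)‖ ^ 2 = 4 * Real.sin (Real.pi * ξ) ^ 2 * ‖𝓕 tent (ξ + k)‖ ^ 2 := by
  rw [fourier_psiOne, norm_mul, mul_pow, norm_sub_rev, Complex.norm_exp_I_mul_ofReal_sub_one]
  congr 1
  rw [Real.norm_eq_abs, sq_abs, mul_pow,
    show -2 * Real.pi * (ξ + k) / 2 = -(Real.pi * ξ + k * Real.pi) by ring, Real.sin_neg, neg_sq,
    Real.sin_add_int_mul_pi, mul_pow]
  rcases Int.even_or_odd k with h | h
  · rw [h.neg_one_zpow]; norm_num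
  · rw [h.neg_one_zpow]; norm_num

theorem hasSum_norm_sq_fourier_psiOne (ξ : ℝ) :
    HasSum (fun k : ℤ => ‖𝓕 psiOne (ξ + k)‖ ^ 2) (4 / 3 * Real.sin (Real.pi * ξ) ^ 2) := by
  simp only [norm_sq_fourier_psiOne]
  convert (hasSum_norm_sq_fourier_tent ξ).mul_left (4 * Real.sin (Real.pi * ξ) ^ 2) using 1
  · rfl
  · ring

theorem periodization_psiOne (ξ : ℝ) :
    periodization psiOne ξ = 4 / 3 * Real.sin (Real.pi * ξ) ^ 2 :=
  (hasSum_norm_sq_fourier_psiOne ξ).tsum_eq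

/-! ### Singularities of `1 / sin²(πx)` -/

/-- `1 / (x - c)²` is not integrable near an endpoint `c`. -/
theorem lintegral_inv_sq_eq_top {c d : ℝ} (hcd : c ≠ d) :
    ∫⁻ x in Set.Ioo (min c d) (max c d), ENNReal.ofReal (((x - c) ^ 2)⁻¹) = ∞ := by
  -- On an interval of length at most `1` the function dominates `|x - c|⁻¹`, which is not
  -- integrable at `c`; a longer interval contains a shorter one with the same endpoint `c`.
  wlog h1 : |d - c| ≤ 1 generalizing d
  · have hp : 0 < |d - c| := abs_pos.2 (sub_ne_zero.2 hcd.symm)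
    have hm : ∃ e, c ≠ e ∧ |e - c| ≤ 1 ∧ min c d ≤ min c e ∧ max c e ≤ max c d := by
      rcases lt_or_gt_of_ne hcd with h | h
      · rw [abs_of_pos (by linarith)] at h1
        refine ⟨c + 1, by linarith, by simp, ?_, ?_⟩
        · rw [min_eq_left h.le, min_eq_left (by linarith)]
        · rw [max_eq_right h.le, max_eq_right (by linarith)]; linarith
      · rw [abs_of_neg (by linarith)] at h1
        refine ⟨c - 1, by linarith, by simp, ?_, ?_⟩
        · rw [min_eq_right h.le, min_eq_right (by linarith)]; linarith
        · rw [max_eq_left h.le, max_eq_left (by linarith)]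
    obtain ⟨e, he1, he2, he3, he4⟩ := hm
    exact top_le_iff.1 ((this he1 he2).ge.trans
      (lintegral_mono_set (Set.Ioo_subset_Ioo he3 he4)))
  have hn : ¬ IntegrableOn (fun x => (x - c)⁻¹) (Set.Ioo (min c d) (max c d)) := by
    rw [← integrableOn_Ioc_iff_integrableOn_Ioo, ← Set.uIoc, ← intervalIntegrable_iff,
      intervalIntegrable_sub_inv_iff]
    simp [hcd]
  have hm : Measurable fun x : ℝ => (x - c)⁻¹ := by fun_prop
  have ht : ∫⁻ x in Set.Ioo (min c d) (max c d), ‖(x - c)⁻¹‖ₑ = ∞ := by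
    by_contra h
    exact hn ⟨hm.aestronglyMeasurable, lt_top_iff_ne_top.2 h⟩
  refine top_le_iff.1 (ht.ge.trans (setLIntegral_mono' measurableSet_Ioo fun x hx => ?_))
  rw [Real.enorm_eq_ofReal_abs]
  apply ENNReal.ofReal_le_ofReal
  have hx0 : x ≠ c := by
    rintro rfl
    rcases lt_or_gt_of_ne hcd with h | h
    · exact absurd hx.1 (by simp [h.le])
    · exact absurd hx.2 (by simp [h.le])
  have hx1 : |x - c| ≤ 1 := (Set.abs_sub_left_of_mem_uIcc
    (Set.mem_Icc_of_Ioo hx)).trans h1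
  have hp : 0 < |x - c| := abs_pos.2 (sub_ne_zero.2 hx0)
  rw [abs_inv, ← sq_abs]
  apply inv_anti₀ (by positivity)
  nlinarith

theorem sq_sin_pi_mul_sub_int (x : ℝ) (m : ℤ) :
    Real.sin (Real.pi * x) ^ 2 = Real.sin (Real.pi * (x - m)) ^ 2 := by
  rw [show Real.pi * (x - m) = Real.pi * x - m * Real.pi by ring, Real.sin_sub_int_mul_pi,
      mul_pow]
  rcases Int.even_or_odd m with h | h <;> rw [h.neg_one_zpow] <;> norm_num

theorem sq_sin_pi_mul_le (x : ℝ) (m : ℤ) :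
    4 / 3 * Real.sin (Real.pi * x) ^ 2 ≤ 4 / 3 * Real.pi ^ 2 * (x - m) ^ 2 := by
  have h2 := Real.sin_sq_le_sq (x := Real.pi * (x - m))
  rw [sq_sin_pi_mul_sub_int x m]
  nlinarith

/-- The weighted integral of `1 / sin²` diverges at an integer where the numerator does not
vanish. -/
theorem lintegral_div_sq_sin_eq_top {m : ℤ} {d : ℝ} (hd : (m : ℝ) ≠ d) {p : ℝ → ℝ} {ε : ℝ}
    (hε : 0 < ε) (hp : ∀ x ∈ Set.Ioo (min (m : ℝ) d) (max (m : ℝ) d), ε ≤ p x) :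
    ∫⁻ x in Set.Ioo (min (m : ℝ) d) (max (m : ℝ) d),
      ENNReal.ofReal (p x) / ENNReal.ofReal (4 / 3 * Real.sin (Real.pi * x) ^ 2) = ∞ := by
  have hc : 0 < 4 / 3 * Real.pi ^ 2 := by positivity
  have hε' : 0 < ε / (4 / 3 * Real.pi ^ 2) := by positivity
  have h : ∫⁻ x in Set.Ioo (min (m : ℝ) d) (max (m : ℝ) d),
      ENNReal.ofReal (ε / (4 / 3 * Real.pi ^ 2)) * ENNReal.ofReal (((x - m) ^ 2)⁻¹) = ∞ := by
    rw [lintegral_const_mul _ (by fun_prop), lintegral_inv_sq_eq_top hd,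
      ENNReal.mul_top (ENNReal.ofReal_pos.2 hε').ne']
  refine top_le_iff.1 (h.ge.trans (setLIntegral_mono' measurableSet_Ioo fun x hx => ?_))
  have hx0 : x - m ≠ 0 := by
    rw [sub_ne_zero]
    rintro rfl
    rcases lt_or_gt_of_ne hd with h | h
    · exact absurd hx.1 (by simp [h.le])
    · exact absurd hx.2 (by simp [h.le])
  have hx2 : 0 < (x - m) ^ 2 := by positivity
  rw [← ENNReal.ofReal_mul hε'.le, div_mul_eq_mul_div, ← div_eq_mul_inv, div_div,
    ENNReal.ofReal_div_of_pos (by positivity)]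
  refine ENNReal.div_le_div (ENNReal.ofReal_le_ofReal (hp x hx)) (ENNReal.ofReal_le_ofReal ?_)
  exact (sq_sin_pi_mul_le x m).trans_eq (mul_comm _ _)

theorem lintegral_Ioo_lt_top_of_le {a b C : ℝ} {f : ℝ → ℝ≥0∞}
    (h : ∀ x ∈ Set.Ioo a b, f x ≤ ENNReal.ofReal C) : ∫⁻ x in Set.Ioo a b, f x < ∞ := by
  refine (setLIntegral_mono' measurableSet_Ioo h).trans_lt ?_
  rw [setLIntegral_const, Real.volume_Ioo]
  exact ENNReal.mul_lt_top ENNReal.ofReal_lt_top ENNReal.ofReal_lt_top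

/-- No positivity of `b` is needed: if `b ≤ 0` then `a ≤ 0`, and `0 / 0 = 0` in `[0, ∞]`. The bound
therefore applies at the zeros of the sine too. -/
theorem ofReal_div_le_of_le_mul {a b C : ℝ} (hC : 0 ≤ C) (h : a ≤ C * b) :
    ENNReal.ofReal a / ENNReal.ofReal b ≤ ENNReal.ofReal C := by
  refine ENNReal.div_le_of_le_mul ?_
  rw [← ENNReal.ofReal_mul hC]
  exact ENNReal.ofReal_le_ofReal h

/-- `sin²(πx)` is comparable to `(x - m)²` on a neighbourhood of `m` of radius `r < 1`. -/
theorem exists_sq_le_mul_sq_sin {m : ℤ} {r : ℝ} (hr : r < 1) :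
    ∃ C, 0 ≤ C ∧ ∀ x ∈ Set.Ioo ((m : ℝ) - r) (m + r),
      (x - m) ^ 2 ≤ C * (4 / 3 * Real.sin (Real.pi * x) ^ 2) := by
  rcases le_or_gt r 0 with h0 | h0
  · exact ⟨0, le_rfl, fun x hx => absurd (hx.1.trans hx.2) (by linarith)⟩
  -- The quotient of `sin²(πx)` by `(πx)²` extends continuously to `0` as `sinc²`, without zeros for
  -- `|x| ≤ r < 1`; its minimum there gives the constant.
  have hs : ∀ x ∈ Set.Icc (-r) r, Real.sinc (Real.pi * x) ^ 2 ≠ 0 := by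
    intro x hx h
    rw [sq_eq_zero_iff] at h
    rcases eq_or_ne x 0 with rfl | hx0
    · simp at h
    rw [Real.sinc_of_ne_zero (by positivity), div_eq_zero_iff] at h
    have hpx : Real.pi * x ≠ 0 := by positivity
    have h := h.resolve_right hpx
    rw [Real.sin_eq_zero_iff] at h
    obtain ⟨n, hn⟩ := h
    have hxn : x = n := by
      have := Real.pi_pos.ne'
      field_simp at hn
      linarith
    rw [hxn] at hx
    have h1 : n < 1 := by exact_mod_cast hx.2.trans_lt hr
    have h2 : -1 < n := by
      have : (-1 : ℝ) < n := by linarith [hx.1]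
      exact_mod_cast this
    apply hx0
    rw [hxn, show n = 0 by omega, Int.cast_zero]
  have hc : Continuous fun x => Real.sinc (Real.pi * x) ^ 2 := by
    have := Real.continuous_sinc
    fun_prop
  obtain ⟨y, hy, hmin⟩ := isCompact_Icc.exists_isMinOn
    (Set.nonempty_Icc.2 (by linarith : -r ≤ r)) hc.continuousOn
  have hδ : 0 < Real.sinc (Real.pi * y) ^ 2 := lt_of_le_of_ne (sq_nonneg _) (hs y hy).symm
  set δ := Real.sinc (Real.pi * y) ^ 2
  refine ⟨(4 / 3 * Real.pi ^ 2 * δ)⁻¹, by positivity, fun x hx => ?_⟩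
  have hx' : δ ≤ Real.sinc (Real.pi * (x - m)) ^ 2 :=
    hmin (show x - m ∈ Set.Icc (-r) r from ⟨by linarith [hx.1], by linarith [hx.2]⟩)
  have he : Real.sin (Real.pi * x) ^ 2 =
      Real.pi ^ 2 * (x - m) ^ 2 * Real.sinc (Real.pi * (x - m)) ^ 2 := by
    rw [sq_sin_pi_mul_sub_int x m]
    rcases eq_or_ne (x - m) 0 with h0 | h0
    · simp [h0]
    · have := Real.pi_pos.ne'
      rw [Real.sinc_of_ne_zero (by positivity)]
      field_simp
  rw [inv_mul_eq_div, le_div_iff₀ (by positivity), he]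
  nlinarith [mul_le_mul_of_nonneg_left hx' (by positivity : 0 ≤ Real.pi ^ 2 * (x - m) ^ 2)]

/-- `sin²(πx)` is bounded below on an interval whose closure has no integer. -/
theorem exists_one_le_mul_sq_sin {a b : ℝ} (hab : a ≤ b) (h : ∀ m : ℤ, (m : ℝ) ∉ Set.Icc a b) :
    ∃ C, 0 ≤ C ∧ ∀ x ∈ Set.Icc a b, 1 ≤ C * (4 / 3 * Real.sin (Real.pi * x) ^ 2) := by
  have hc : Continuous fun x : ℝ => 4 / 3 * Real.sin (Real.pi * x) ^ 2 := by fun_prop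
  obtain ⟨y, hy, hmin⟩ := isCompact_Icc.exists_isMinOn (Set.nonempty_Icc.2 hab) hc.continuousOn
  have hy0 : Real.sin (Real.pi * y) ≠ 0 := by
    rw [Real.sin_ne_zero_iff]
    intro n hn
    have hyn : y = n := by
      have := Real.pi_pos.ne'
      field_simp at hn
      linarith
    exact h n (hyn ▸ hy)
  have hδ : 0 < 4 / 3 * Real.sin (Real.pi * y) ^ 2 := by positivity
  refine ⟨(4 / 3 * Real.sin (Real.pi * y) ^ 2)⁻¹, by positivity, fun x hx => ?_⟩
  rw [inv_mul_eq_div, le_div_iff₀ hδ, one_mul]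
  exact hmin hx

/-- The numerator `(x - x₀)^(2k)` does not compensate a zero of `sin²(πx)` at another integer. -/
theorem lintegral_div_sq_sin_eq_top_of_ne {m : ℤ} {x₀ r : ℝ} (hm : (m : ℝ) ≠ x₀)
    (hr : (m : ℝ) ∈ Set.Icc (x₀ - r) (x₀ + r)) (k : ℕ) :
    ∫⁻ x in Set.Ioo (x₀ - r) (x₀ + r), ENNReal.ofReal ((x - x₀) ^ (2 * k)) /
      ENNReal.ofReal (4 / 3 * Real.sin (Real.pi * x) ^ 2) = ∞ := by
  -- Between `m` and the midpoint of `m` and `x₀` the distance to `x₀` is at least `|m - x₀| / 2`.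
  -- This half-interval lies inside even when `m` is an endpoint.
  have hd : (m : ℝ) ≠ (m + x₀) / 2 := fun h => hm (by linarith)
  have hε : 0 < |(m - x₀) / 2| := abs_pos.2 (div_ne_zero (sub_ne_zero.2 hm) two_ne_zero)
  have ht := lintegral_div_sq_sin_eq_top hd (p := fun x => (x - x₀) ^ (2 * k))
    (pow_pos (pow_pos hε 2) k) (fun x hx => by
      rw [pow_mul, ← sq_abs (x - x₀)]
      refine pow_le_pow_left₀ (sq_nonneg _) (pow_le_pow_left₀ (abs_nonneg _) ?_ 2) k
      rcases lt_or_gt_of_ne hm with h | h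
      · rw [min_eq_left (by linarith), max_eq_right (by linarith)] at hx
        rw [abs_of_neg (by linarith), abs_of_neg (by linarith [hx.2])]
        linarith [hx.2]
      · rw [min_eq_right (by linarith), max_eq_left (by linarith)] at hx
        rw [abs_of_pos (by linarith), abs_of_pos (by linarith [hx.1])]
        linarith [hx.1])
  refine top_le_iff.1 (ht.ge.trans (lintegral_mono_set (Set.Ioo_subset_Ioo ?_ ?_)))
  · rw [le_min_iff]
    constructor <;> linarith [hr.1, hr.2]
  · rw [max_le_iff]
    constructor <;> linarith [hr.1, hr.2]

theorem hasSingularityOfOrder_periodization_psiOne (x₀ : ℝ) (k : ℕ) :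
    HasSingularityOfOrder (periodization psiOne) k x₀ ↔ (∃ m : ℤ, x₀ = m) ∧ k = 1 := by
  unfold HasSingularityOfOrder
  simp only [periodization_psiOne]
  constructor
  · rintro ⟨hk, r, hr, h1, h2⟩
    -- The radius is not assumed small, but finiteness of the second integral keeps every integer
    -- other than `x₀` out of the closed interval.
    have hno : ∀ m : ℤ, (m : ℝ) ≠ x₀ → (m : ℝ) ∉ Set.Icc (x₀ - r) (x₀ + r) := fun m hm hmr =>
      h2.ne (lintegral_div_sq_sin_eq_top_of_ne hm hmr k)
    by_cases hx : ∃ m : ℤ, x₀ = m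
    · refine ⟨hx, ?_⟩
      obtain ⟨m, rfl⟩ := hx
      by_contra hk1
      have hr1 : r < 1 := by
        by_contra hr1
        refine hno (m + 1) (by push_cast; linarith) ⟨?_, ?_⟩ <;> push_cast <;> linarith
      obtain ⟨C, hC, hb⟩ := exists_sq_le_mul_sq_sin (m := m) hr1
      refine h1.not_lt (lintegral_Ioo_lt_top_of_le (C := C) fun x hx =>
        ofReal_div_le_of_le_mul hC (le_trans ?_ (hb x hx)))
      -- Here `k ≥ 2`: one factor `(x - m)²` cancels the double zero and the remaining power is at
      -- most `1`, so the first integral would be finite.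
      rw [show 2 * (k - 1) = 2 * (k - 2) + 2 by omega, pow_add, pow_mul]
      refine mul_le_of_le_one_left (sq_nonneg _) (pow_le_one₀ (sq_nonneg _) ?_)
      rw [sq_le_one_iff_abs_le_one, abs_le]
      constructor <;> linarith [hx.1, hx.2]
    · exfalso
      obtain ⟨C, hC, hb⟩ := exists_one_le_mul_sq_sin (by linarith : x₀ - r ≤ x₀ + r)
        fun m => hno m fun h => hx ⟨m, h.symm⟩
      refine h1.not_lt (lintegral_Ioo_lt_top_of_le (C := (r ^ 2) ^ (k - 1) * C) fun x hx =>
        ofReal_div_le_of_le_mul (by positivity) ?_)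
      have h3 := hb x (Set.Ioo_subset_Icc_self hx)
      rw [mul_assoc, pow_mul]
      refine (?_ : _ ≤ (r ^ 2) ^ (k - 1) * 1).trans (by gcongr)
      rw [mul_one]
      gcongr ?_ ^ _
      apply sq_le_sq' <;> linarith [hx.1, hx.2]
  · rintro ⟨⟨m, rfl⟩, rfl⟩
    refine ⟨le_rfl, 1 / 2, by norm_num, ?_, ?_⟩
    · have ht := lintegral_div_sq_sin_eq_top (m := m) (d := m + 1 / 2) (by linarith)
        (p := fun x => (x - m) ^ (2 * (1 - 1))) one_pos (fun x _ => by simp)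
      refine top_le_iff.1 (ht.ge.trans (lintegral_mono_set (Set.Ioo_subset_Ioo ?_ ?_)))
      · rw [min_eq_left] <;> linarith
      · rw [max_eq_right]; linarith
    · obtain ⟨C, hC, hb⟩ := exists_sq_le_mul_sq_sin (m := m) (r := 1 / 2) (by norm_num)
      exact lintegral_Ioo_lt_top_of_le (C := C) fun x hx =>
        ofReal_div_le_of_le_mul hC (hb x hx)

/-! ### Cesàro weights -/

theorem cesaroNumber_zero (α : ℝ) : cesaroNumber α 0 = 1 := by simp [cesaroNumber]

theorem cesaroNumber_succ (α : ℝ) (n : ℕ) :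
    cesaroNumber α (n + 1) = cesaroNumber α n * ((α + (n + 1)) / (n + 1)) := by
  unfold cesaroNumber
  rw [Finset.prod_range_succ]

theorem cesaroNumber_pos {α : ℝ} (hα : 0 < α) (n : ℕ) : 0 < cesaroNumber α n :=
  Finset.prod_pos fun j _ => by positivity

theorem cesaroNumber_monotone {α : ℝ} (hα : 0 < α) : Monotone (cesaroNumber α) := by
  refine monotone_nat_of_le_succ fun n => ?_
  rw [cesaroNumber_succ]
  refine le_mul_of_one_le_right (cesaroNumber_pos hα n).le ?_
  rw [one_le_div (by positivity)]
  linarith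

theorem cesaroNumber_succ_sub {α : ℝ} (hα : 0 < α) (n : ℕ) :
    cesaroNumber α (n + 1) - cesaroNumber α n =
      α * (cesaroNumber α (n + 1) / (α + (n + 1 : ℕ))) := by
  rw [cesaroNumber_succ]
  push_cast
  have : α + ((n : ℝ) + 1) ≠ 0 := by positivity
  field_simp
  ring

/-- The square sum of the Cesàro numbers of order `α - 1`, in the form
`A_i^(α-1) = α A_i^α / (α + i)`. -/
theorem sum_sq_cesaroNumber_div_le {α : ℝ} (hα : 1 / 2 < α) (n : ℕ) :
    ∑ i ∈ Finset.range (n + 1), (cesaroNumber α i / (α + i)) ^ 2 ≤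
      cesaroNumber α n ^ 2 / ((2 * α - 1) * (n + 1)) := by
  have h0 : 0 < 2 * α - 1 := by linarith
  have hα0 : 0 < α := by linarith
  induction n with
  | zero =>
    simp only [zero_add, Finset.sum_range_one, cesaroNumber_zero, Nat.cast_zero, add_zero, mul_one]
    rw [div_pow, one_pow]
    exact one_div_le_one_div_of_le h0 (by nlinarith [sq_nonneg (α - 1)])
  | succ n ih =>
    rw [Finset.sum_range_succ]
    refine (add_le_add_left ih _).trans ?_
    rw [cesaroNumber_succ]
    have hA := cesaroNumber_pos hα0 n
    push_cast
    set A := cesaroNumber α n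
    set t : ℝ := n + 1 with ht
    have ht0 : 0 < t := by positivity
    rw [div_pow, div_add_div _ _ (by positivity) (by positivity), div_le_div_iff₀ (by positivity)
      (by positivity)]
    -- The two sides differ by exactly `t (α - 1)²`.
    have key : t ^ 2 * (t + 1) + (2 * α - 1) * t * (t + 1) ≤ (α + t) ^ 2 * t := by
      nlinarith [mul_nonneg ht0.le (sq_nonneg (α - 1))]
    have e1 : (A ^ 2 * (α + t) ^ 2 + (2 * α - 1) * t * (A * ((α + t) / t)) ^ 2) *
        ((2 * α - 1) * (t + 1)) = (A ^ 2 * (α + t) ^ 2 * (2 * α - 1) / t ^ 2) *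
          (t ^ 2 * (t + 1) + (2 * α - 1) * t * (t + 1)) := by
      field_simp
    have e2 : (A * ((α + t) / t)) ^ 2 * ((2 * α - 1) * t * (α + t) ^ 2) =
        (A ^ 2 * (α + t) ^ 2 * (2 * α - 1) / t ^ 2) * ((α + t) ^ 2 * t) := by
      field_simp
    rw [e1, e2]
    gcongr

/-- The weight `A_{n-m}^α / A_n^α` of the `m`-th term in the `n`-th Cesàro mean. -/
noncomputable def cesaroWeight (α : ℝ) (n m : ℕ) : ℝ :=
  if m ≤ n then cesaroNumber α (n - m) / cesaroNumber α n else 0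

theorem cesaroWeight_eq_zero {α : ℝ} {n m : ℕ} (h : n < m) : cesaroWeight α n m = 0 :=
  if_neg (by omega)

theorem cesaroWeight_zero_right {α : ℝ} (hα : 0 < α) (n : ℕ) : cesaroWeight α n 0 = 1 := by
  simp [cesaroWeight, (cesaroNumber_pos hα n).ne']

theorem cesaroWeight_nonneg {α : ℝ} (hα : 0 < α) (n m : ℕ) : 0 ≤ cesaroWeight α n m := by
  unfold cesaroWeight
  have := cesaroNumber_pos hα n
  have := cesaroNumber_pos hα (n - m)
  split_ifs <;> positivity

theorem cesaroWeight_le_one {α : ℝ} (hα : 0 < α) (n m : ℕ) : cesaroWeight α n m ≤ 1 := by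
  unfold cesaroWeight
  split_ifs
  · rw [div_le_one (cesaroNumber_pos hα n)]
    exact cesaroNumber_monotone hα (Nat.sub_le n m)
  · exact zero_le_one

theorem cesaroWeight_sub {α : ℝ} (hα : 0 < α) {n m : ℕ} (h : m ≤ n) :
    cesaroWeight α n m - cesaroWeight α n (m + 1) =
      α / cesaroNumber α n * (cesaroNumber α (n - m) / (α + (n - m : ℕ))) := by
  unfold cesaroWeight
  rw [if_pos h]
  rcases h.eq_or_lt with rfl | h
  · rw [if_neg (by omega), Nat.sub_self, cesaroNumber_zero]
    have := (cesaroNumber_pos hα m).ne'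
    simp only [Nat.cast_zero, add_zero]
    field_simp
    simp
  · obtain ⟨i, hi⟩ : ∃ i, n - m = i + 1 := ⟨n - m - 1, by omega⟩
    rw [if_pos (by omega), show n - (m + 1) = i by omega, hi, ← sub_div,
      cesaroNumber_succ_sub hα]
    ring

/-- The increments are `A_i^(α-1) / A_n^α` with `i = n - m`, so this is the square sum bound for
Cesàro numbers of order `α - 1`. The set `F` is arbitrary so that images under injective reindexings
can be inserted. -/
theorem sum_sq_cesaroWeight_sub_le {α : ℝ} (hα : 1 / 2 < α) (n : ℕ) (F : Finset ℕ) :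
    ∑ m ∈ F, (cesaroWeight α n m - cesaroWeight α n (m + 1)) ^ 2 ≤
      α ^ 2 / (2 * α - 1) / (n + 1) := by
  have h0 : 0 < 2 * α - 1 := by linarith
  have hα0 : 0 < α := by linarith
  have hA := cesaroNumber_pos hα0 n
  calc ∑ m ∈ F, (cesaroWeight α n m - cesaroWeight α n (m + 1)) ^ 2
      ≤ ∑ m ∈ F ∪ Finset.range (n + 1),
          (cesaroWeight α n m - cesaroWeight α n (m + 1)) ^ 2 :=
        Finset.sum_le_sum_of_subset_of_nonneg Finset.subset_union_left fun _ _ _ => sq_nonneg _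
    _ = ∑ m ∈ Finset.range (n + 1), (cesaroWeight α n m - cesaroWeight α n (m + 1)) ^ 2 := by
        refine (Finset.sum_subset Finset.subset_union_right fun m _ hm => ?_).symm
        rw [Finset.mem_range] at hm
        rw [cesaroWeight_eq_zero (by omega), cesaroWeight_eq_zero (by omega)]
        simp
    _ = (α / cesaroNumber α n) ^ 2 *
          ∑ i ∈ Finset.range (n + 1), (cesaroNumber α i / (α + i)) ^ 2 := by
        rw [← Finset.sum_range_reflect, Finset.mul_sum]
        refine Finset.sum_congr rfl fun m hm => ?_
        rw [Finset.mem_range] at hm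
        rw [cesaroWeight_sub hα0 (by omega), mul_pow, show n - (n + 1 - 1 - m) = m by omega]
    _ ≤ (α / cesaroNumber α n) ^ 2 * (cesaroNumber α n ^ 2 / ((2 * α - 1) * (n + 1))) := by
        gcongr
        exact sum_sq_cesaroNumber_div_le hα n
    _ = α ^ 2 / (2 * α - 1) / (n + 1) := by
        field_simp

theorem tendsto_const_div_nat_succ (C : ℝ) :
    Tendsto (fun n : ℕ => C / ((n : ℝ) + 1)) atTop (𝓝 0) :=
  tendsto_const_nhds.div_atTop (tendsto_natCast_atTop_atTop.atTop_add tendsto_const_nhds)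

theorem tendsto_cesaroWeight {α : ℝ} (hα : 1 / 2 < α) (m : ℕ) :
    Tendsto (fun n => cesaroWeight α n m) atTop (𝓝 1) := by
  induction m with
  | zero => simp [cesaroWeight_zero_right (show 0 < α by linarith)]
  | succ m ih =>
    -- A single increment is bounded by the whole square sum, which is `O(1/n)`.
    have h : Tendsto (fun n => (cesaroWeight α n m - cesaroWeight α n (m + 1)) ^ 2) atTop
        (𝓝 0) := squeeze_zero (fun n => sq_nonneg _)
      (fun n => by simpa using sum_sq_cesaroWeight_sub_le hα n {m})
      (tendsto_const_div_nat_succ (α ^ 2 / (2 * α - 1)))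
    have h2 : Tendsto (fun n => cesaroWeight α n m - cesaroWeight α n (m + 1)) atTop (𝓝 0) := by
      rw [tendsto_zero_iff_abs_tendsto_zero]
      have := h.sqrt
      simpa [Real.sqrt_sq_eq_abs, Function.comp_def] using this
    simpa using ih.sub h2

theorem cesaroMean_eq {E : Type*} [NormedAddCommGroup E] [NormedSpace ℂ E]
    (α : ℝ) (u : ℕ → E) (n : ℕ) :
    cesaroMean α u n = ∑ k ∈ Finset.range (n + 1), (cesaroWeight α n k : ℂ) • u k := by
  unfold cesaroMean
  rw [Finset.smul_sum]
  refine Finset.sum_congr rfl fun k hk => ?_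
  rw [Finset.mem_range] at hk
  rw [smul_smul, cesaroWeight, if_pos (by omega), div_eq_inv_mul]
  push_cast
  rfl

/-! ### Differences of the unit vectors of `ℓ²(ℤ)` -/

/-- The vectors `e_k - e_{k-1}`, `k ≠ 0`, of `ℓ²(ℤ)`. -/
noncomputable def diffSystem (k : {k : ℤ // k ≠ 0}) : lp (fun _ : ℤ => ℂ) 2 :=
  lp.single 2 (k : ℤ) 1 - lp.single 2 ((k : ℤ) - 1) 1

/-- The solution `b` of `b_j - b_{j+1} = z_j`, `b_0 = 0`. -/
noncomputable def diffCoeff (z : ℤ → ℂ) (k : ℤ) : ℂ :=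
  ∑ i ∈ Finset.Ico k 0, z i - ∑ i ∈ Finset.Ico 0 k, z i

theorem diffCoeff_zero (z : ℤ → ℂ) : diffCoeff z 0 = 0 := by simp [diffCoeff]

theorem diffCoeff_sub (z : ℤ → ℂ) (j : ℤ) : diffCoeff z j - diffCoeff z (j + 1) = z j := by
  unfold diffCoeff
  rcases le_or_gt 0 j with h | h
  · have e : Finset.Ico 0 (j + 1) = insert j (Finset.Ico 0 j) := by
      ext i
      simp only [Finset.mem_Ico, Finset.mem_insert]
      omega
    rw [e, Finset.sum_insert (by simp), Finset.Ico_eq_empty (a := j) (b := 0) (by omega),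
      Finset.Ico_eq_empty (a := j + 1) (b := 0) (by omega)]
    simp
  · have e : Finset.Ico j 0 = insert j (Finset.Ico (j + 1) 0) := by
      ext i
      simp only [Finset.mem_Ico, Finset.mem_insert]
      omega
    rw [e, Finset.sum_insert (by simp), Finset.Ico_eq_empty (a := 0) (b := j) (by omega),
      Finset.Ico_eq_empty (a := 0) (b := j + 1) (by omega)]
    simp

theorem eq_diffCoeff {z a : ℤ → ℂ} (h0 : a 0 = 0) (h : ∀ j, a j - a (j + 1) = z j) :
    a = diffCoeff z := by
  have hs : ∀ j, a (j + 1) - diffCoeff z (j + 1) = a j - diffCoeff z j := fun j => by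
    linear_combination diffCoeff_sub z j - h j
  have h1 : ∀ j, a j - diffCoeff z j = 0 := fun j => by
    induction j with
    | zero => rw [h0, diffCoeff_zero, sub_zero]
    | succ n ih => rw [hs, ih]
    | pred n ih => rw [← hs, sub_add_cancel, ih]
  exact funext fun j => sub_eq_zero.1 (h1 j)

theorem summable_norm_sq_lp (z : lp (fun _ : ℤ => ℂ) 2) : Summable fun i => ‖z i‖ ^ 2 := by
  simpa using (lp.hasSum_norm (by norm_num) z).summable

theorem norm_sq_lp (z : lp (fun _ : ℤ => ℂ) 2) : ‖z‖ ^ 2 = ∑' i, ‖z i‖ ^ 2 := by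
  simpa using (lp.hasSum_norm (by norm_num) z).tsum_eq.symm

/-- Partial sums of a square summable sequence grow like `o(√k)`. -/
theorem norm_sq_diffCoeff_le (z : lp (fun _ : ℤ => ℂ) 2) {ε : ℝ} (hε : 0 < ε) :
    ∃ K, 0 ≤ K ∧ ∀ k : ℤ, ‖diffCoeff z k‖ ^ 2 ≤ K + ε * |(k : ℝ)| := by
  -- The finite set `T` carries all but `ε / 2` of the square sum. Its contribution is a constant;
  -- off `T`, Cauchy–Schwarz gives `|k| ε / 2`, and `(x + y)² ≤ 2x² + 2y²` combines the two.
  obtain ⟨T, hT⟩ := summable_iff_vanishing_norm.1 (summable_norm_sq_lp z) (ε / 2) (by positivity)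
  refine ⟨2 * (∑ i ∈ T, ‖z i‖) ^ 2, by positivity, fun k => ?_⟩
  set s := Finset.Ico k 0 ∪ Finset.Ico 0 k with hs
  have hd : Disjoint (Finset.Ico k 0) (Finset.Ico 0 k) := by
    rw [Finset.disjoint_left]
    intro i
    simp only [Finset.mem_Ico]
    omega
  have hcard : (s.card : ℝ) = |(k : ℝ)| := by
    rw [hs, Finset.card_union_of_disjoint hd, Int.card_Ico, Int.card_Ico, ← Int.cast_abs]
    have : (((0 - k).toNat + (k - 0).toNat : ℕ) : ℤ) = |k| := by
      rcases abs_cases k with h | h <;> omega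
    exact_mod_cast this
  have h1 : ‖diffCoeff z k‖ ≤ ∑ i ∈ s, ‖z i‖ := by
    rw [hs, Finset.sum_union hd]
    exact (norm_sub_le _ _).trans (add_le_add (norm_sum_le _ _) (norm_sum_le _ _))
  have h2 : ∑ i ∈ s, ‖z i‖ ≤ ∑ i ∈ T, ‖z i‖ + ∑ i ∈ s \ T, ‖z i‖ := by
    rw [← Finset.sum_inter_add_sum_sdiff s T]
    gcongr
    exact Finset.inter_subset_right
  have h3 : (∑ i ∈ s \ T, ‖z i‖) ^ 2 ≤ |(k : ℝ)| * (ε / 2) := by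
    refine sq_sum_le_card_mul_sum_sq.trans ?_
    rw [← hcard]
    have h4 : ((s \ T).card : ℝ) ≤ s.card := by
      exact_mod_cast Finset.card_le_card Finset.sdiff_subset
    have h5 := hT (s \ T) Finset.sdiff_disjoint
    have h6 : ∑ i ∈ s \ T, ‖z i‖ ^ 2 ≤ ε / 2 := (le_abs_self _).trans h5.le
    exact mul_le_mul h4 h6 (by positivity) (by positivity)
  have h7 : ‖diffCoeff z k‖ ^ 2 ≤ (∑ i ∈ T, ‖z i‖ + ∑ i ∈ s \ T, ‖z i‖) ^ 2 := by
    gcongr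
    exact h1.trans h2
  nlinarith [sq_nonneg (∑ i ∈ T, ‖z i‖ - ∑ i ∈ s \ T, ‖z i‖)]

/-- Square sums of the increments of a Cesàro weight along an enumeration `idx` of the integers
that moves by at most two places from `j` to `j + 1`, in the window starting at `u j`. -/
theorem sum_sq_cesaroWeight_comp_sub_le {α : ℝ} (hα : 1 / 2 < α) {idx u : ℤ → ℕ}
    (hu₁ : Set.InjOn u {j | 0 ≤ j}) (hu₂ : Set.InjOn u {j | j < 0})
    (hd : ∀ j, idx j = idx (j + 1) ∨ idx j ∈ Set.Icc (u j) (u j + 2) ∧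
      idx (j + 1) ∈ Set.Icc (u j) (u j + 2)) (n : ℕ) (s : Finset ℤ) :
    ∑ j ∈ s, (cesaroWeight α n (idx j) - cesaroWeight α n (idx (j + 1))) ^ 2 ≤
      8 * (α ^ 2 / (2 * α - 1)) / (n + 1) := by
  set δ : ℕ → ℝ := fun m => (cesaroWeight α n m - cesaroWeight α n (m + 1)) ^ 2 with hδ
  have hδ0 : ∀ m, 0 ≤ δ m := fun m => sq_nonneg _
  have h1 : ∀ j, (cesaroWeight α n (idx j) - cesaroWeight α n (idx (j + 1))) ^ 2 ≤
      2 * δ (u j) + 2 * δ (u j + 1) := by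
    intro j
    rcases hd j with h | ⟨h, h'⟩
    · rw [h, sub_self]
      rw [zero_pow two_ne_zero]
      linarith [hδ0 (u j), hδ0 (u j + 1)]
    · rw [Set.mem_Icc] at h h'
      have c : idx j = u j ∨ idx j = u j + 1 ∨ idx j = u j + 1 + 1 := by omega
      have c' : idx (j + 1) = u j ∨ idx (j + 1) = u j + 1 ∨ idx (j + 1) = u j + 1 + 1 := by omega
      simp only [hδ]
      generalize cesaroWeight α n = W at *
      rcases c with c | c | c <;> rcases c' with c' | c' | c' <;> rw [c, c'] <;>
        nlinarith [sq_nonneg (W (u j) - W (u j + 1)), sq_nonneg (W (u j + 1) - W (u j + 1 + 1)),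
          sq_nonneg (W (u j) - W (u j + 1) - (W (u j + 1) - W (u j + 1 + 1)))]
  -- Along an injective `u` no increment is counted twice in either sum. The nonnegative and the
  -- negative `j` each cost a factor `2 + 2`, whence the `8`.
  have h2 : ∀ t : Finset ℤ, Set.InjOn u t → ∑ j ∈ t, (2 * δ (u j) + 2 * δ (u j + 1)) ≤
      4 * (α ^ 2 / (2 * α - 1) / (n + 1)) := by
    intro t ht
    have a1 : ∑ j ∈ t, δ (u j) ≤ α ^ 2 / (2 * α - 1) / (n + 1) := by
      rw [← Finset.sum_image (f := δ) ht]
      exact sum_sq_cesaroWeight_sub_le hα n _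
    have a2 : ∑ j ∈ t, δ (u j + 1) ≤ α ^ 2 / (2 * α - 1) / (n + 1) := by
      have ht' : Set.InjOn (fun j => u j + 1) t := fun i hi j hj h => ht hi hj (by simpa using h)
      rw [← Finset.sum_image (f := δ) ht']
      exact sum_sq_cesaroWeight_sub_le hα n _
    rw [Finset.sum_add_distrib, ← Finset.mul_sum, ← Finset.mul_sum]
    linarith
  refine (Finset.sum_le_sum fun j _ => h1 j).trans ?_
  rw [← Finset.sum_filter_add_sum_filter_not s (fun j => 0 ≤ j)]
  have b1 := h2 (s.filter fun j => 0 ≤ j) 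
    (hu₁.mono fun j hj => (Finset.mem_filter.1 hj).2)
  have b2 := h2 (s.filter fun j => ¬ 0 ≤ j)
    (hu₂.mono fun j hj => not_le.1 (Finset.mem_filter.1 hj).2)
  refine (add_le_add b1 b2).trans_eq ?_
  ring

/-! ### Cesàro means in coordinates and their convergence -/

/-- Extension by `0` of coefficients indexed by the nonzero integers. -/
def extendZero (a : {k : ℤ // k ≠ 0} → ℂ) (k : ℤ) : ℂ := if h : k ≠ 0 then a ⟨k, h⟩ else 0

theorem extendZero_zero (a : {k : ℤ // k ≠ 0} → ℂ) : extendZero a 0 = 0 := by simp [extendZero]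

theorem extendZero_coe (a : {k : ℤ // k ≠ 0} → ℂ) (k : {k : ℤ // k ≠ 0}) :
    extendZero a k = a k := by
  simp [extendZero, k.2]

/-- The number `idx j` is the position of the block containing `j`. The value `idx 0` is free,
because the coefficient at `0` vanishes. -/
theorem sum_block_ite {α : ℝ} {block : ℕ → Finset {k : ℤ // k ≠ 0}} {idx : ℤ → ℕ}
    (hblock : ∀ m (k : {k : ℤ // k ≠ 0}), k ∈ block m ↔ idx k = m)
    (a : {k : ℤ // k ≠ 0} → ℂ) (n : ℕ) (j : ℤ) :
    ∑ m ∈ Finset.range (n + 1), (cesaroWeight α n m : ℂ) *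
      ∑ k ∈ block m, a k * (if j = k then 1 else 0) =
    cesaroWeight α n (idx j) * extendZero a j := by
  by_cases hj : j = 0
  · subst hj
    rw [extendZero_zero, mul_zero]
    refine Finset.sum_eq_zero fun m _ => ?_
    rw [Finset.sum_eq_zero, mul_zero]
    intro k _
    rw [if_neg k.2.symm, mul_zero]
  · have h : ∀ m, ∑ k ∈ block m, a k * (if j = k then 1 else 0) =
        if m = idx j then a ⟨j, hj⟩ else 0 := by
      intro m
      have h1 : ∀ k : {k : ℤ // k ≠ 0}, a k * (if j = k then 1 else 0) =
          if k = ⟨j, hj⟩ then a k else 0 := fun k => by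
        by_cases hk : j = k
        · subst hk; simp
        · rw [if_neg hk, if_neg (fun h => hk (by rw [h])), mul_zero]
      simp only [h1, Finset.sum_ite_eq', hblock, eq_comm]
    simp_rw [h]
    simp only [mul_ite, mul_zero, Finset.sum_ite_eq', Finset.mem_range]
    rw [extendZero, dif_pos hj]
    split_ifs with hn
    · rfl
    · rw [cesaroWeight_eq_zero (by omega)]
      simp

/-- The coordinates of the Cesàro means of a series in the system `e_k - e_{k-1}`. -/
theorem cesaroMean_diffSystem_apply {α : ℝ} {block : ℕ → Finset {k : ℤ // k ≠ 0}} {idx : ℤ → ℕ}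
    (hblock : ∀ m (k : {k : ℤ // k ≠ 0}), k ∈ block m ↔ idx k = m)
    (a : {k : ℤ // k ≠ 0} → ℂ) (n : ℕ) (j : ℤ) :
    cesaroMean α (fun m => ∑ k ∈ block m, a k • diffSystem k) n j =
      cesaroWeight α n (idx j) * extendZero a j -
        cesaroWeight α n (idx (j + 1)) * extendZero a (j + 1) := by
  rw [← sum_block_ite hblock, ← sum_block_ite hblock, ← Finset.sum_sub_distrib, cesaroMean_eq,
    lp.coeFn_sum, Finset.sum_apply]
  refine Finset.sum_congr rfl fun m _ => ?_
  rw [lp.coeFn_smul, Pi.smul_apply, smul_eq_mul, ← mul_sub, ← Finset.sum_sub_distrib, lp.coeFn_sum,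
    Finset.sum_apply]
  congr 1
  refine Finset.sum_congr rfl fun k _ => ?_
  rw [lp.coeFn_smul, Pi.smul_apply, smul_eq_mul, ← mul_sub, diffSystem, lp.coeFn_sub, Pi.sub_apply,
    lp.single_apply, lp.single_apply]
  congr 2
  · simp [Pi.single_apply]
  · simp [Pi.single_apply, eq_sub_iff_add_eq]

/-- The continuous functional `z ↦ diffCoeff z k` on `ℓ²(ℤ)`. -/
noncomputable def diffCoeffCLM (k : ℤ) : lp (fun _ : ℤ => ℂ) 2 →L[ℂ] ℂ :=
  ∑ i ∈ Finset.Ico k 0, lp.evalCLM ℂ (fun _ : ℤ => ℂ) 2 i -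
    ∑ i ∈ Finset.Ico 0 k, lp.evalCLM ℂ (fun _ : ℤ => ℂ) 2 i

theorem diffCoeffCLM_apply (k : ℤ) (z : lp (fun _ : ℤ => ℂ) 2) :
    diffCoeffCLM k z = diffCoeff z k := by
  simp only [diffCoeffCLM, diffCoeff, sub_apply, sum_apply]
  rfl

theorem diffCoeff_diffSystem (k j : {k : ℤ // k ≠ 0}) :
    diffCoeff (diffSystem j) k = if k = j then 1 else 0 := by
  have h : (fun i : ℤ => if i = j then (1 : ℂ) else 0) = diffCoeff (diffSystem j) := by
    refine eq_diffCoeff (if_neg j.2.symm) fun i => ?_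
    rw [diffSystem, lp.coeFn_sub, Pi.sub_apply, lp.single_apply, lp.single_apply]
    simp [Pi.single_apply, eq_sub_iff_add_eq]
  rw [← h]
  simp only [Subtype.ext_iff]

/-- Dominated convergence for the series of squared norms, with majorant `‖z j‖²`. -/
theorem tendsto_norm_lp_smul {p : ℕ → ℤ → ℝ} {q : ℕ → lp (fun _ : ℤ => ℂ) 2}
    {z : lp (fun _ : ℤ => ℂ) 2} (hq : ∀ n j, q n j = (1 - p n j : ℝ) * z j)
    (h0 : ∀ n j, 0 ≤ p n j) (h1 : ∀ n j, p n j ≤ 1)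
    (hp : ∀ j, Tendsto (p · j) atTop (𝓝 1)) : Tendsto q atTop (𝓝 0) := by
  have h : Tendsto (fun n => ‖q n‖ ^ 2) atTop (𝓝 0) := by
    simp only [norm_sq_lp]
    rw [← tsum_zero (α := ℝ) (β := ℤ)]
    refine tendsto_tsum_of_dominated_convergence (summable_norm_sq_lp z) (fun j => ?_)
      (Eventually.of_forall fun n j => ?_)
    · have : Tendsto (fun n => (|1 - p n j| * ‖z j‖) ^ 2) atTop (𝓝 ((|1 - 1| * ‖z j‖) ^ 2)) :=
        ((((hp j).const_sub 1).abs).mul_const _).pow 2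
      simp only [hq, norm_mul, Complex.norm_real, Real.norm_eq_abs]
      simpa using this
    · rw [hq, norm_mul, Complex.norm_real, Real.norm_eq_abs, Real.norm_eq_abs, abs_of_nonneg
        (by positivity)]
      have : |1 - p n j| ≤ 1 := by
        rw [abs_le]
        constructor <;> linarith [h0 n j, h1 n j]
      gcongr
      exact mul_le_of_le_one_left (norm_nonneg _) this
  rw [tendsto_zero_iff_norm_tendsto_zero]
  simpa using h.sqrt

/-- The squared norm is `∑ d² |g|² ≤ D / (n + 1) * (K + ε (n + 1))`, which is eventually as small as
`D ε` allows. -/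
theorem tendsto_sum_single_zero {d : ℕ → ℤ → ℝ} {g : ℤ → ℂ} {D : ℝ} (hD : 0 ≤ D)
    (hd : ∀ (n : ℕ) (s : Finset ℤ), ∑ j ∈ s, d n j ^ 2 ≤ D / (n + 1))
    (hg : ∀ ε > 0, ∃ K, 0 ≤ K ∧ ∀ (n : ℕ), ∀ j ∈ Finset.Icc (-(n + 2) : ℤ) (n + 2),
      ‖g j‖ ^ 2 ≤ K + ε * (n + 1)) :
    Tendsto (fun n : ℕ => ∑ j ∈ Finset.Icc (-(n + 2) : ℤ) (n + 2),
      (lp.single 2 j (d n j * g j) : lp (fun _ : ℤ => ℂ) 2)) atTop (𝓝 0) := by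
  have h : Tendsto (fun n : ℕ => ‖∑ j ∈ Finset.Icc (-(n + 2) : ℤ) (n + 2),
      (lp.single 2 j (d n j * g j) : lp (fun _ : ℤ => ℂ) 2)‖ ^ 2) atTop (𝓝 0) := by
    rw [tendsto_order]
    refine ⟨fun a ha => Eventually.of_forall fun n => ha.trans_le (sq_nonneg _), fun a ha => ?_⟩
    -- With `D + 1` in place of `D` the choice also covers `D = 0`.
    obtain ⟨K, hK, hKg⟩ := hg (a / (2 * (D + 1))) (by positivity)
    filter_upwards [(tendsto_const_div_nat_succ (D * K)).eventually_lt_const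
      (show (0 : ℝ) < a / 2 by positivity)] with n hn
    have hs := lp.norm_sum_single (E := fun _ : ℤ => ℂ) (p := 2) (by norm_num)
      (fun j => (d n j * g j : ℂ)) (Finset.Icc (-(n + 2) : ℤ) (n + 2))
    simp only [ENNReal.toReal_ofNat, Real.rpow_ofNat] at hs
    rw [hs]
    calc ∑ j ∈ Finset.Icc (-(n + 2) : ℤ) (n + 2), ‖(d n j * g j : ℂ)‖ ^ 2
        ≤ ∑ j ∈ Finset.Icc (-(n + 2) : ℤ) (n + 2),
            d n j ^ 2 * (K + a / (2 * (D + 1)) * (n + 1)) := by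
          refine Finset.sum_le_sum fun j hj => ?_
          rw [norm_mul, Complex.norm_real, Real.norm_eq_abs, mul_pow, sq_abs]
          exact mul_le_mul_of_nonneg_left (hKg n j hj) (sq_nonneg _)
      _ ≤ D / (n + 1) * (K + a / (2 * (D + 1)) * (n + 1)) := by
          rw [← Finset.sum_mul]
          gcongr
          exact hd n _
      _ = D * K / (n + 1) + D / (D + 1) * (a / 2) := by
          field_simp
      _ ≤ D * K / (n + 1) + 1 * (a / 2) := by
          gcongr
          rw [div_le_one (by positivity)]
          linarith
      _ < a := by linarith
  rw [tendsto_zero_iff_norm_tendsto_zero]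
  simpa using h.sqrt

/-- The system `e_k - e_{k-1}`, `k ≠ 0`, is a `(C, α)` summation basis of `ℓ²(ℤ)` for every
`α > 1/2`, for every blocking along an enumeration of the integers with bounded steps. -/
theorem isCesaroBasis_diffSystem {α : ℝ} (hα : 1 / 2 < α)
    {block : ℕ → Finset {k : ℤ // k ≠ 0}} {idx u : ℤ → ℕ}
    (hblock : ∀ m (k : {k : ℤ // k ≠ 0}), k ∈ block m ↔ idx k = m)
    (hidx : ∀ k : ℤ, k.natAbs ≤ idx k + 1)
    (hu₁ : Set.InjOn u {j | 0 ≤ j}) (hu₂ : Set.InjOn u {j | j < 0})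
    (hd : ∀ j, idx j = idx (j + 1) ∨ idx j ∈ Set.Icc (u j) (u j + 2) ∧
      idx (j + 1) ∈ Set.Icc (u j) (u j + 2)) :
    IsCesaroBasis α diffSystem block := by
  have hα0 : 0 < α := by linarith
  refine ⟨fun k => diffCoeffCLM k, fun k j => ?_, fun z a => ?_⟩
  · rw [diffCoeffCLM_apply, diffCoeff_diffSystem]
  simp only [diffCoeffCLM_apply]
  constructor
  · intro h k
    have hw : ∀ j, Tendsto (fun n => (cesaroWeight α n (idx j) : ℂ)) atTop (𝓝 1) := fun j => by
      exact_mod_cast (Complex.continuous_ofReal.tendsto 1).comp (tendsto_cesaroWeight hα (idx j))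
    -- Norm convergence implies convergence of each coordinate, and each fixed weight tends to `1`.
    have hz : ∀ j, extendZero a j - extendZero a (j + 1) = z j := by
      intro j
      have h1 := ((lp.evalCLM ℂ (fun _ : ℤ => ℂ) 2 j).continuous.tendsto z).comp h
      have h2 := ((hw j).mul_const (extendZero a j)).sub
        ((hw (j + 1)).mul_const (extendZero a (j + 1)))
      rw [one_mul, one_mul] at h2
      refine tendsto_nhds_unique h2 (h1.congr fun n => ?_)
      exact cesaroMean_diffSystem_apply hblock a n j
    rw [← extendZero_coe a k, eq_diffCoeff (extendZero_zero a) hz]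
  · intro h
    have ha : extendZero a = diffCoeff z := by
      funext k
      by_cases hk : k = 0
      · rw [hk, extendZero_zero, diffCoeff_zero]
      · exact (extendZero_coe a ⟨k, hk⟩).trans (h ⟨k, hk⟩)
    set W := fun n j => cesaroWeight α n (idx j) with hW
    -- Summation by parts, arranged so that `g j` is the coefficient whose index is nearer to `0`.
    set p : ℕ → ℤ → ℝ := fun n j => if 0 ≤ j then W n (j + 1) else W n j with hp
    set g : ℤ → ℂ := fun j => if 0 ≤ j then diffCoeff z j else diffCoeff z (j + 1) with hg
    set d : ℕ → ℤ → ℝ := fun n j => W n j - W n (j + 1) with hdd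
    have hσ : ∀ n j, cesaroMean α (fun m => ∑ k ∈ block m, a k • diffSystem k) n j =
        p n j * z j + d n j * g j := by
      intro n j
      rw [cesaroMean_diffSystem_apply hblock, ha]
      simp only [hp, hg, hdd, hW]
      push_cast
      split_ifs
      · linear_combination (cesaroWeight α n (idx (j + 1)) : ℂ) * diffCoeff_sub z j
      · linear_combination (cesaroWeight α n (idx j) : ℂ) * diffCoeff_sub z j
    have hR : Tendsto (fun n : ℕ => ∑ j ∈ Finset.Icc (-(n + 2) : ℤ) (n + 2),
        (lp.single 2 j (d n j * g j) : lp (fun _ : ℤ => ℂ) 2)) atTop (𝓝 0) := by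
      have h2 : 0 < 2 * α - 1 := by linarith
      refine tendsto_sum_single_zero (D := 8 * (α ^ 2 / (2 * α - 1))) (by positivity)
        (sum_sq_cesaroWeight_comp_sub_le hα hu₁ hu₂ hd) fun ε hε => ?_
      obtain ⟨K, hK, hKb⟩ := norm_sq_diffCoeff_le z (half_pos hε)
      refine ⟨K, hK, fun n j hj => ?_⟩
      have hb : ∀ i : ℤ, |i| ≤ n + 2 → ‖diffCoeff z i‖ ^ 2 ≤ K + ε * (n + 1) := by
        intro i hi
        have hi' : |(i : ℝ)| ≤ n + 2 := by exact_mod_cast hi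
        refine (hKb i).trans ?_
        nlinarith [mul_nonneg hε.le (Nat.cast_nonneg (α := ℝ) n)]
      rw [Finset.mem_Icc] at hj
      simp only [hg]
      split_ifs with h0
      · exact hb _ (abs_le.2 ⟨by omega, by omega⟩)
      · exact hb _ (abs_le.2 ⟨by omega, by omega⟩)
    -- Truncation loses nothing: if `|j| ≥ n + 3`, then `hidx` puts both `idx j` and `idx (j + 1)`
    -- beyond `n`, where the weights vanish.
    have hRapply : ∀ (n : ℕ) (j : ℤ), (∑ i ∈ Finset.Icc (-(n + 2) : ℤ) (n + 2),
        (lp.single 2 i (d n i * g i) : lp (fun _ : ℤ => ℂ) 2)) j = d n j * g j := by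
      intro n j
      simp only [lp.coeFn_sum, Finset.sum_apply, lp.coeFn_single, Finset.sum_pi_single]
      split_ifs with hj
      · rfl
      · rw [Finset.mem_Icc] at hj
        have h1 := hidx j
        have h2 := hidx (j + 1)
        simp only [hdd, hW]
        rw [cesaroWeight_eq_zero (by omega), cesaroWeight_eq_zero (by omega)]
        simp
    have hQ := tendsto_norm_lp_smul (p := p) (z := z)
      (q := fun n => z - cesaroMean α (fun m => ∑ k ∈ block m, a k • diffSystem k) n +
        ∑ j ∈ Finset.Icc (-(n + 2) : ℤ) (n + 2), lp.single 2 j (d n j * g j))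
      (fun n j => by
        rw [lp.coeFn_add, Pi.add_apply, lp.coeFn_sub, Pi.sub_apply, hσ, hRapply]
        push_cast
        ring)
      (fun n j => by
        simp only [hp, hW]
        split_ifs <;> exact cesaroWeight_nonneg hα0 _ _)
      (fun n j => by
        simp only [hp, hW]
        split_ifs <;> exact cesaroWeight_le_one hα0 _ _)
      (fun j => by
        simp only [hp, hW]
        split_ifs <;> exact tendsto_cesaroWeight hα _)
    have := ((hR.sub hQ).const_add z)
    simpa using this

/-! ### The two orders of summation -/

theorem isCesaroBasis_diffSystem_symmetricBlock {α : ℝ} (hα : 1 / 2 < α) :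
    IsCesaroBasis α diffSystem symmetricBlock := by
  refine isCesaroBasis_diffSystem hα (idx := Int.natAbs)
    (u := fun j => if 0 ≤ j then j.natAbs else (j + 1).natAbs)
    (fun m k => mem_symmetricBlock m k) (fun k => by omega) ?_ ?_ fun j => Or.inr ?_
  · intro i hi j hj h
    simp only [Set.mem_ofPred_eq] at hi hj
    simp only [hi, hj, if_true] at h
    omega
  · intro i hi j hj h
    simp only [Set.mem_ofPred_eq] at hi hj
    simp only [not_le.2 hi, not_le.2 hj, if_false] at h
    omega
  · simp only [Set.mem_Icc]
    split_ifs <;> omega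

theorem naturalEnum_coe (m : ℕ) : (naturalEnum m : ℤ) =
    if m % 2 = 0 then ((m / 2 : ℕ) : ℤ) + 1 else -(((m / 2 : ℕ) : ℤ) + 1) := by
  unfold naturalEnum
  split_ifs <;> rfl

theorem isCesaroBasis_diffSystem_singleBlock {α : ℝ} (hα : 1 / 2 < α) :
    IsCesaroBasis α diffSystem singleBlock := by
  refine isCesaroBasis_diffSystem hα
    -- Truncated subtraction gives `idx 0 = 0 = idx 1`, so the step at `j = 0` is trivial. The value
    -- `u 0 = 1` only has to differ from the even values of `u` at positive `j`.
    (idx := fun k => if 0 < k then 2 * k.natAbs - 2 else 2 * k.natAbs - 1)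
    (u := fun j => if 0 < j then 2 * j.natAbs - 2 else if j = 0 then 1 else 2 * (j + 1).natAbs - 1)
    (fun m k => ?_) (fun k => ?_) ?_ ?_ fun j => ?_
  · have := k.2
    rw [singleBlock, Finset.mem_singleton, Subtype.ext_iff, naturalEnum_coe]
    split_ifs <;> omega
  · split_ifs <;> omega
  · intro i hi j hj h
    simp only [Set.mem_ofPred_eq] at hi hj
    simp only at h
    split_ifs at h <;> omega
  · intro i hi j hj h
    simp only [Set.mem_ofPred_eq] at hi hj
    simp only at h
    split_ifs at h <;> omega
  · simp only [Set.mem_Icc]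
    split_ifs <;> omega

/-! ### Transfer to the shift-invariant space -/

/-- A summation basis is carried along a multiple of a linear isometry, and restricts to a subspace
of the range that contains it. -/
theorem IsCesaroBasis.of_linearIsometry {E F ι : Type*} [NormedAddCommGroup F]
    [InnerProductSpace ℂ F] [CompleteSpace F] [NormedAddCommGroup E] [InnerProductSpace ℂ E]
    [CompleteSpace E] [DecidableEq ι] {α : ℝ} {y' : ι → F} {block : ℕ → Finset ι}
    (h : IsCesaroBasis α y' block) (V : F →ₗᵢ[ℂ] E) {r : ℂ} (hr : r ≠ 0) {S : Submodule ℂ E}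
    {y : ι → S} (hy : ∀ k, (y k : E) = r • V (y' k)) (hS : ∀ x ∈ S, ∃ z, V z = x) :
    IsCesaroBasis α y block := by
  obtain ⟨c, hc, hb⟩ := h
  -- The adjoint of an isometry is a continuous left inverse defined on all of `E`, so it carries
  -- the coefficient functionals over to `S`.
  set V' := ContinuousLinearMap.adjoint V.toContinuousLinearMap with hV'
  have hVV : ∀ z, V' (V z) = z := fun z =>
    DFunLike.congr_fun ((ContinuousLinearMap.norm_map_iff_adjoint_comp_self
      V.toContinuousLinearMap).1 V.norm_map) z
  refine ⟨fun k => r⁻¹ • (c k ∘L V' ∘L S.subtypeL), fun k j => ?_, fun x a => ?_⟩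
  · change r⁻¹ * c k (V' (y j : E)) = _
    rw [hy, map_smul, hVV, map_smul, hc, smul_eq_mul, inv_mul_cancel_left₀ hr]
  · obtain ⟨z, hz⟩ := hS x x.2
    have hm : ∀ n, ((cesaroMean α (fun m => ∑ k ∈ block m, a k • y k) n : S) : E) =
        r • V (cesaroMean α (fun m => ∑ k ∈ block m, a k • y' k) n) := by
      intro n
      simp only [cesaroMean_eq, map_sum, map_smul, Finset.smul_sum, Submodule.coe_sum,
        Submodule.coe_smul, hy, smul_comm r]
    -- The means in `S` are the images under `r • V` of the means in `F`, so the target there is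
    -- `r⁻¹ • z`.
    have hx : (x : E) = r • V (r⁻¹ • z) := by
      rw [map_smul, smul_inv_smul₀ hr, hz]
    rw [tendsto_subtype_rng]
    simp only [hm]
    rw [hx, tendsto_const_smul_iff₀ hr]
    have ht := V.isometry.isEmbedding.tendsto_nhds_iff
      (f := cesaroMean α (fun m => ∑ k ∈ block m, a k • y' k)) (l := atTop) (y := r⁻¹ • z)
    rw [Function.comp_def] at ht
    rw [← ht, hb]
    refine forall_congr' fun k => ?_
    change _ ↔ a k = r⁻¹ * c k (V' (x : E))
    rw [← hz, hVV, map_smul, smul_eq_mul]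

/-- Distinct translates are nonzero only on disjoint unit intervals. -/
theorem inner_shiftLp_tent (i j : ℤ) :
    inner ℂ (shiftLp tent tent_memLp i) (shiftLp tent tent_memLp j) =
      if i = j then (1 / 3 : ℂ) else 0 := by
  have h : inner ℂ (shiftLp tent tent_memLp i) (shiftLp tent tent_memLp j) =
      ∫ x : ℝ, inner ℂ (tent (x + i)) (tent (x + j)) := by
    rw [L2.inner_def]
    refine integral_congr_ae ?_
    filter_upwards [shiftLp_coe tent tent_memLp i, shiftLp_coe tent tent_memLp j] with x h1 h2
    rw [h1, h2]
  rw [h]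
  split_ifs with hij
  · subst hij
    rw [integral_add_right_eq_self (fun x => inner ℂ (tent x) (tent x)),
      ← setIntegral_eq_integral_of_forall_compl_eq_zero (s := Set.Ioc 0 1),
      ← intervalIntegral.integral_of_le zero_le_one]
    · simp only [inner_self_eq_norm_sq_to_K]
      have := integral_norm_sq_tent
      have h2 : ∫ x in (0 : ℝ)..1, ((‖tent x‖ ^ 2 : ℝ) : ℂ) = ((1 / 3 : ℝ) : ℂ) := by
        rw [intervalIntegral.integral_ofReal, this]
      push_cast at h2
      exact h2
    · intro t ht
      rw [tent_eq_zero fun h => ht (Set.Ioo_subset_Ioc_self h), inner_zero_left]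
  · rw [integral_eq_zero_of_ae]
    refine Eventually.of_forall fun x => ?_
    by_cases h1 : x + i ∈ Set.Ioo (0 : ℝ) 1
    · by_cases h2 : x + j ∈ Set.Ioo (0 : ℝ) 1
      · exfalso
        apply hij
        have h3 : (i : ℝ) < j + 1 := by linarith [h1.2, h2.1]
        have h4 : (j : ℝ) < i + 1 := by linarith [h1.1, h2.2]
        have h3' : i < j + 1 := by exact_mod_cast h3
        have h4' : j < i + 1 := by exact_mod_cast h4
        omega
      · simp [tent_eq_zero h2]
    · simp [tent_eq_zero h1]

theorem orthonormal_shiftLp_tent :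
    Orthonormal ℂ fun k : ℤ => ((Real.sqrt 3 : ℝ) : ℂ) • shiftLp tent tent_memLp k := by
  rw [orthonormal_iff_ite]
  intro i j
  rw [inner_smul_left, inner_smul_right, inner_shiftLp_tent, Complex.conj_ofReal, ← mul_assoc,
    ← Complex.ofReal_mul, Real.mul_self_sqrt (by norm_num)]
  split_ifs <;> norm_num

theorem shiftLp_psiOne (k : ℤ) :
    shiftLp psiOne psiOne_memLp k =
      shiftLp tent tent_memLp k - shiftLp tent tent_memLp (k - 1) := by
  apply Lp.ext
  filter_upwards [shiftLp_coe psiOne psiOne_memLp k, shiftLp_coe tent tent_memLp k,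
    shiftLp_coe tent tent_memLp (k - 1),
    Lp.coeFn_sub (shiftLp tent tent_memLp k) (shiftLp tent tent_memLp (k - 1))] with x h1 h2 h3 h4
  rw [h1, h4, Pi.sub_apply, h2, h3, psiOne_eq_tent]
  push_cast
  ring_nf

theorem IsCesaroBasis.shiftSystem_psiOne {α : ℝ} {block : ℕ → Finset {k : ℤ // k ≠ 0}}
    (h : IsCesaroBasis α diffSystem block) :
    IsCesaroBasis α (shiftSystem psiOne psiOne_memLp) block := by
  set V := orthonormal_shiftLp_tent.orthogonalFamily.linearIsometry with hV
  have h3 : ((Real.sqrt 3 : ℝ) : ℂ) ≠ 0 := by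
    rw [Complex.ofReal_ne_zero]
    positivity
  have hVs : ∀ k : ℤ, V (lp.single 2 k 1) =
      ((Real.sqrt 3 : ℝ) : ℂ) • shiftLp tent tent_memLp k := fun k => by
    rw [hV, OrthogonalFamily.linearIsometry_apply_single]
    simp
  have hy : ∀ k : ℤ, shiftLp psiOne psiOne_memLp k =
      ((Real.sqrt 3 : ℝ) : ℂ)⁻¹ • V (lp.single 2 k 1 - lp.single 2 (k - 1) 1) := fun k => by
    rw [map_sub, hVs, hVs, ← smul_sub, inv_smul_smul₀ h3, shiftLp_psiOne]
  refine h.of_linearIsometry V (inv_ne_zero h3) (fun k => hy k) fun x hx => ?_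
  have hle : shiftSpace psiOne psiOne_memLp ≤ LinearMap.range V.toLinearMap := by
    -- The range of an isometry on a complete space is closed, so it suffices that it contains the
    -- generators.
    refine Submodule.topologicalClosure_minimal _ (Submodule.span_le.2 ?_)
      V.isometry.isUniformInducing.isComplete_range.isClosed
    rintro _ ⟨k, rfl⟩
    rw [hy]
    exact Submodule.smul_mem _ _ ⟨_, rfl⟩
  exact hle hx

theorem mainTheorem6 :
    (∀ ξ : ℝ, Summable (fun k : ℤ => ‖𝓕 psiOne (ξ + k)‖ ^ 2) ∧
      periodization psiOne ξ = 4 / 3 * Real.sin (Real.pi * ξ) ^ 2) ∧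
    (∀ (x₀ : ℝ) (k : ℕ), HasSingularityOfOrder (periodization psiOne) k x₀ ↔
      (∃ m : ℤ, x₀ = m) ∧ k = 1) ∧
    (∀ α : ℝ, 1 / 2 < α →
      IsCesaroBasis α (shiftSystem psiOne psiOne_memLp) singleBlock ∧
      IsCesaroBasis α (shiftSystem psiOne psiOne_memLp) symmetricBlock) :=
  ⟨fun ξ => ⟨(hasSum_norm_sq_fourier_psiOne ξ).summable, periodization_psiOne ξ⟩,
    hasSingularityOfOrder_periodization_psiOne, fun _ hα =>
    ⟨(isCesaroBasis_diffSystem_singleBlock hα).shiftSystem_psiOne,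
      (isCesaroBasis_diffSystem_symmetricBlock hα).shiftSystem_psiOne⟩⟩
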